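/- For positive integers $p,q$ let $F_{p,q}=K_1\vee pK_q$ be the generalized friendship graph on $pq+1$ vertices, obtained by joining one vertex to every vertex of $p$ disjoint copies of the complete graph $K_q$. For a finite simple graph $G$ with vertex degrees $d_v$, let $\mathcal L(G)=(l_{uv})$ be its normalized Laplacian matrix: $l_{uv}=1$ if $u=v$ and $u$ is not isolated, $l_{uv}=-1/\sqrt{d_ud_v}$ if $u$ and $v$ are adjacent, and $l_{uv}=0$ otherwise. Let $Sp(G)$ be the multiset of all eigenvalues of $\mathcal L(G)$, counted with multiplicity. If $q\ge 2$, or if $q=1$ and $p\le 2$, then $F_{p,q}$ is determined by its normalized Laplacian spectrum: every finite simple graph $G$ with $Sp(G)=Sp(F_{p,q})$ is isomorphic to $F_{p,q}$. If $q=1$ and $p\ge 3$ (so that $F_{p,q}$ is the star $K_{1,p}$), then there is a graph $G$ that is not isomorphic to $F_{p,q}$ and satisfies $Sp(G)=Sp(F_{p,q})$; moreover $G$ can be taken to be a complete bipartite graph $K_{r,s}$ with $r,s\ge 1$ and $r+s=p+1$. -/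

import Mathlib

universe u v

namespace NormLap

/-- The join of two graphs: the disjoint union of `G` and `H`, together with all edges between
the vertices of `G` and the vertices of `H`. -/
def join {V W : Type*} (G : SimpleGraph V) (H : SimpleGraph W) : SimpleGraph (V ⊕ W) :=
  SimpleGraph.sum G H ⊔ completeBipartiteGraph V W

/-- The disjoint union of `p` copies of `G`; the vertex `(i, v)` is the vertex `v` in copy `i`. -/
def copies {V : Type*} (p : ℕ) (G : SimpleGraph V) : SimpleGraph (Fin p × V) where
  Adj a b := a.1 = b.1 ∧ G.Adj a.2 b.2
  symm := ⟨fun _ _ h => ⟨h.1.symm, h.2.symm⟩⟩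
  loopless := ⟨fun _ h => G.irrefl h.2⟩

/-- The generalized friendship graph `K₁ ∨ pK_q`. -/
def friendshipGraph (p q : ℕ) : SimpleGraph (Fin 1 ⊕ Fin p × Fin q) :=
  join (⊤ : SimpleGraph (Fin 1)) (copies p (⊤ : SimpleGraph (Fin q)))

open Classical in
/-- The normalized Laplacian matrix of a finite simple graph. -/
noncomputable def normalizedLaplacian {V : Type*} [Fintype V] (G : SimpleGraph V) :
    Matrix V V ℝ :=
  Matrix.of fun u v =>
    if u = v ∧ G.degree u ≠ 0 then 1
    else if G.Adj u v then -(1 / Real.sqrt ((G.degree u : ℝ) * (G.degree v : ℝ)))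
    else 0

open Classical in
/-- The normalized Laplacian spectrum: the multiset of all eigenvalues of the normalized
Laplacian matrix, each repeated according to its multiplicity. The matrix is real symmetric, so
all the roots of its characteristic polynomial are real. -/
noncomputable def spectrum {V : Type*} [Fintype V] (G : SimpleGraph V) : Multiset ℝ :=
  (normalizedLaplacian G).charpoly.roots

/-- `G` is determined by its normalized Laplacian spectrum: every finite simple graph with the
same spectrum is isomorphic to `G`. -/
def DeterminedBySpectrum {V : Type u} [Fintype V] (G : SimpleGraph V) : Prop :=
  ∀ (W : Type v) [Fintype W] (H : SimpleGraph W), spectrum H = spectrum G → Nonempty (H ≃g G)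

end NormLap

/-! Apart from a simple 0, every normalized Laplacian eigenvalue of `F_{p,q}` is a = 1/q or b = 1 +
1/q. If a cospectral `G` has at least two vertices, then L(L - a)(L - b) = 0, so the columns of (L -
a)(L - b) lie in ker L, the line spanned by the square roots of the degrees. By symmetry this matrix
is a multiple of a rank-one square; rescaling by D^{1/2} gives A D⁻¹ A - (2 - a - b)A + (1 - a)(1 -
b)D = c d dᵀ with c · vol = ab (`exists_quadratic_relation`). From here on only this identity and
the number of vertices are used.

Its entries give the sum of reciprocal degrees over a neighbourhood, over common neighbours, and
over neighbours of `u` not adjacent to `v`. Estimating these sums shows that all degrees are at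
least q (`le_rdeg`) and that some degree equals q (`exists_rdeg_eq_of_two_le`; for q = 1 this needs
at most three vertices). A vertex of degree q yields a vertex `u` with q²c·d_u = 1
(`exists_center_of_rdeg_eq`). This equation says that the projection onto the 1/q-eigenspace has
zero diagonal entry at `u`, so its whole row vanishes: `u` is adjacent to every other vertex, and
those all have degree q (`adj_and_rdeg_eq_of_center`). Off `u` adjacency is transitive, so the rest
is a union of cliques of order q.

For q = 1 all complete bipartite graphs on p + 1 vertices have simple eigenvalue 0 and the others in
{1, 2}; the trace fixes the multiplicities, so they are all cospectral. -/

namespace Matrix.IsHermitian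

/-! ### Eigenvalues of real symmetric matrices -/

variable {V : Type*} [Fintype V] [DecidableEq V] {A : Matrix V V ℝ}

theorem charpoly_roots_eq_map_eigenvalues (hA : A.IsHermitian) :
    A.charpoly.roots = Multiset.map hA.eigenvalues Finset.univ.val := by
  rw [hA.roots_charpoly_eq_eigenvalues]
  rfl

theorem card_roots_charpoly (hA : A.IsHermitian) :
    Multiset.card A.charpoly.roots = Fintype.card V := by
  simp [hA.charpoly_roots_eq_map_eigenvalues]

theorem sum_roots_charpoly (hA : A.IsHermitian) : A.charpoly.roots.sum = A.trace :=
  (trace_eq_sum_roots_charpoly_of_splits hA.splits_charpoly).symm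

/-- The rank counts the nonzero eigenvalues, so rank-nullity applies. This turns a simple root 0
into a one-dimensional kernel. -/
theorem count_zero_roots_charpoly (hA : A.IsHermitian) :
    A.charpoly.roots.count 0 = Module.finrank ℝ (LinearMap.ker A.mulVecLin) := by
  have h1 := LinearMap.finrank_range_add_finrank_ker A.mulVecLin
  have h2 : Module.finrank ℝ (LinearMap.range A.mulVecLin) =
      Fintype.card {i // hA.eigenvalues i ≠ 0} := hA.rank_eq_card_non_zero_eigs
  rw [h2, Module.finrank_fintype_fun_eq_card, Fintype.card_subtype_compl] at h1
  have h3 : A.charpoly.roots.count 0 = Fintype.card {i // hA.eigenvalues i = 0} := by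
    rw [hA.charpoly_roots_eq_map_eigenvalues, Multiset.count_map, Fintype.card_subtype]
    simp only [eq_comm]
    rfl
  have h4 := Fintype.card_subtype_le (fun i => hA.eigenvalues i = 0)
  omega

theorem exists_mulVec_eq_smul_of_mem_roots (hA : A.IsHermitian) {μ : ℝ}
    (h : μ ∈ A.charpoly.roots) : ∃ v : V → ℝ, v ≠ 0 ∧ A *ᵥ v = μ • v := by
  rw [hA.charpoly_roots_eq_map_eigenvalues, Multiset.mem_map] at h
  obtain ⟨i, -, rfl⟩ := h
  refine ⟨hA.eigenvectorBasis i, fun h0 => ?_, hA.mulVec_eigenvectorBasis i⟩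
  apply hA.eigenvectorBasis.orthonormal.ne_zero i
  ext j
  exact congrFun h0 j

/-- The product kills each vector of an orthonormal eigenbasis. -/
theorem mul_sub_mul_sub_eq_zero (hA : A.IsHermitian) {a b : ℝ}
    (h : ∀ x ∈ A.charpoly.roots, x = 0 ∨ x = a ∨ x = b) :
    A * ((A - a • 1) * (A - b • 1)) = 0 := by
  have key : ∀ i, (A * ((A - a • 1) * (A - b • 1))) *ᵥ (hA.eigenvectorBasis i) = 0 := by
    intro i
    have hi : hA.eigenvalues i ∈ A.charpoly.roots := by
      rw [hA.charpoly_roots_eq_map_eigenvalues, Multiset.mem_map]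
      exact ⟨i, Finset.mem_univ_val i, rfl⟩
    rw [← mulVec_mulVec, ← mulVec_mulVec]
    simp only [sub_mulVec, smul_mulVec, one_mulVec, mulVec_sub, mulVec_smul,
      hA.mulVec_eigenvectorBasis i]
    ext j
    simp only [Pi.sub_apply, Pi.smul_apply, smul_eq_mul, Pi.zero_apply]
    rcases h _ hi with h | h | h <;> rw [h] <;> ring
  have hU : (A * ((A - a • 1) * (A - b • 1))) * (hA.eigenvectorUnitary : Matrix V V ℝ) = 0 := by
    ext i j
    exact congrFun (key j) i
  have := congrArg (· * star (hA.eigenvectorUnitary : Matrix V V ℝ)) hU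
  simpa [mul_assoc, Unitary.coe_mul_star_self] using this

theorem exists_eq_smul_of_count_zero_eq_one (hA : A.IsHermitian)
    (h : A.charpoly.roots.count 0 = 1) {x y : V → ℝ} (hx : A *ᵥ x = 0) (hy : A *ᵥ y = 0)
    (hy0 : y ≠ 0) : ∃ k : ℝ, x = k • y := by
  rw [hA.count_zero_roots_charpoly] at h
  let y' : LinearMap.ker A.mulVecLin := ⟨y, by simpa using hy⟩
  have hy' : y' ≠ 0 := fun h0 => hy0 (congrArg Subtype.val h0)
  obtain ⟨k, hk⟩ := (finrank_eq_one_iff_of_nonzero' y' hy').1 h ⟨x, by simpa using hx⟩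
  exact ⟨k, (congrArg Subtype.val hk).symm⟩

theorem count_zero_eq_one (hA : A.IsHermitian) {y : V → ℝ} (hy : A *ᵥ y = 0) (hy0 : y ≠ 0)
    (h : ∀ x, A *ᵥ x = 0 → ∃ k : ℝ, k • y = x) : A.charpoly.roots.count 0 = 1 := by
  rw [hA.count_zero_roots_charpoly]
  let y' : LinearMap.ker A.mulVecLin := ⟨y, by simpa using hy⟩
  have hy' : y' ≠ 0 := fun h0 => hy0 (congrArg Subtype.val h0)
  refine (finrank_eq_one_iff_of_nonzero' y' hy').2 fun w => ?_
  obtain ⟨k, hk⟩ := h w.1 (LinearMap.mem_ker.1 w.2)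
  exact ⟨k, Subtype.ext hk⟩

end Matrix.IsHermitian

/-! ### The normalized Laplacian in terms of real weights, and the quadratic relation -/

namespace NormLap

section Weights

variable {V : Type*} (G : SimpleGraph V)

open Classical in
/-- The entries of the adjacency matrix, as real numbers. -/
noncomputable def adjInd (u v : V) : ℝ := if G.Adj u v then 1 else 0

theorem adjInd_comm (u v : V) : adjInd G u v = adjInd G v u := by
  by_cases h : G.Adj u v
  · simp [adjInd, h, h.symm]
  · simp [adjInd, h, mt SimpleGraph.Adj.symm h]

theorem adjInd_self (u : V) : adjInd G u u = 0 := by simp [adjInd]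

theorem adjInd_nonneg (u v : V) : 0 ≤ adjInd G u v := by
  unfold adjInd; split_ifs <;> norm_num

theorem adjInd_le_one (u v : V) : adjInd G u v ≤ 1 := by
  unfold adjInd; split_ifs <;> norm_num

variable {G} in
theorem adjInd_of_adj {u v : V} (h : G.Adj u v) : adjInd G u v = 1 := by simp [adjInd, h]

variable {G} in
theorem adjInd_of_not_adj {u v : V} (h : ¬ G.Adj u v) : adjInd G u v = 0 := by simp [adjInd, h]

theorem adjInd_mul_self (u v : V) : adjInd G u v * adjInd G u v = adjInd G u v := by
  unfold adjInd; split_ifs <;> norm_num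

variable [Fintype V]

/-- The degree of a vertex, as a real number. -/
noncomputable def rdeg (u : V) : ℝ := ∑ v, adjInd G u v

open Classical in
theorem natCast_degree (u : V) : (G.degree u : ℝ) = rdeg G u := by
  simp only [rdeg, adjInd, Finset.sum_boole, ← G.card_neighborFinset_eq_degree]
  congr 2
  ext w
  simp

open Classical in
theorem exists_nat_rdeg (u : V) : ∃ k : ℕ, rdeg G u = k := ⟨_, (natCast_degree G u).symm⟩

theorem rdeg_nonneg (u : V) : 0 ≤ rdeg G u := Finset.sum_nonneg fun v _ => adjInd_nonneg G u v

theorem adjInd_eq_zero_of_rdeg_eq_zero {u : V} (h : rdeg G u = 0) (v : V) : adjInd G u v = 0 :=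
  (Finset.sum_eq_zero_iff_of_nonneg fun w _ => adjInd_nonneg G u w).1 h v (Finset.mem_univ v)

-- Isolated vertices need no separate case in the second term: their adjacency entries vanish and
-- division by zero gives 0.
open Classical in
theorem normalizedLaplacian_apply (u v : V) :
    normalizedLaplacian G u v = (if u = v ∧ rdeg G u ≠ 0 then 1 else 0) -
      adjInd G u v / (Real.sqrt (rdeg G u) * Real.sqrt (rdeg G v)) := by
  simp only [normalizedLaplacian, Matrix.of_apply, natCast_degree]
  have h0 : G.degree u ≠ 0 ↔ rdeg G u ≠ 0 := by rw [← natCast_degree, Nat.cast_ne_zero]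
  rw [Real.sqrt_mul (rdeg_nonneg G u)]
  by_cases h : u = v
  · subst h
    simp [h0, adjInd_self]
  · by_cases h' : G.Adj u v <;> simp [h, h', adjInd]

theorem isHermitian_normalizedLaplacian : (normalizedLaplacian G).IsHermitian := by
  classical
  ext u v
  simp only [Matrix.conjTranspose_apply, star_trivial, normalizedLaplacian_apply]
  rw [adjInd_comm G v u, mul_comm (Real.sqrt (rdeg G v))]
  congr 1
  by_cases h : u = v
  · subst h; rfl
  · simp [h, Ne.symm h]

open Classical in
theorem card_spectrum : Multiset.card (spectrum G) = Fintype.card V :=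
  (isHermitian_normalizedLaplacian G).card_roots_charpoly

theorem trace_normalizedLaplacian (hd : ∀ u, rdeg G u ≠ 0) :
    (normalizedLaplacian G).trace = Fintype.card V := by
  simp [Matrix.trace, normalizedLaplacian_apply, hd, adjInd_self]

open Classical in
theorem sum_spectrum (hd : ∀ u, rdeg G u ≠ 0) : (spectrum G).sum = Fintype.card V := by
  rw [← trace_normalizedLaplacian G hd]
  exact (isHermitian_normalizedLaplacian G).sum_roots_charpoly

theorem normalizedLaplacian_mulVec_sqrt :
    Matrix.mulVec (normalizedLaplacian G) (fun v => Real.sqrt (rdeg G v)) = 0 := by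
  classical
  ext u
  simp only [Matrix.mulVec, dotProduct, normalizedLaplacian_apply, sub_mul, Pi.zero_apply,
    Finset.sum_sub_distrib]
  by_cases hu : rdeg G u = 0
  · simp [hu]
  · have h1 : ∀ v, adjInd G u v / (Real.sqrt (rdeg G u) * Real.sqrt (rdeg G v)) *
        Real.sqrt (rdeg G v) = adjInd G u v / Real.sqrt (rdeg G u) := by
      intro v
      by_cases hv : rdeg G v = 0
      · rw [adjInd_comm, adjInd_eq_zero_of_rdeg_eq_zero G hv]; simp
      · have : Real.sqrt (rdeg G v) ≠ 0 := (Real.sqrt_ne_zero (rdeg_nonneg G v)).2 hv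
        have : Real.sqrt (rdeg G u) ≠ 0 := (Real.sqrt_ne_zero (rdeg_nonneg G u)).2 hu
        field_simp
    simp only [h1, ← Finset.sum_div]
    rw [← rdeg, Real.div_sqrt]
    simp [hu]

/-- The eigenvector equation in terms of the function `f = D^{-1/2} v`. -/
theorem sum_adjInd_mul_of_eigenvector (hd : ∀ u, rdeg G u ≠ 0) {v : V → ℝ} {μ : ℝ}
    (hv : Matrix.mulVec (normalizedLaplacian G) v = μ • v) (u : V) :
    ∑ w, adjInd G u w * (v w / Real.sqrt (rdeg G w)) =
      (1 - μ) * rdeg G u * (v u / Real.sqrt (rdeg G u)) := by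
  classical
  have h := congrFun hv u
  simp only [Matrix.mulVec, dotProduct, normalizedLaplacian_apply, sub_mul, Pi.smul_apply,
    Finset.sum_sub_distrib, smul_eq_mul] at h
  have hs : ∀ u, Real.sqrt (rdeg G u) ≠ 0 := fun u =>
    (Real.sqrt_ne_zero (rdeg_nonneg G u)).2 (hd u)
  simp only [hd, ne_eq, not_false_eq_true, and_true, ite_mul, one_mul, zero_mul,
    Finset.sum_ite_eq, Finset.mem_univ, if_true] at h
  have h2 : ∑ w, adjInd G u w * (v w / Real.sqrt (rdeg G w)) = Real.sqrt (rdeg G u) *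
      ∑ w, adjInd G u w / (Real.sqrt (rdeg G u) * Real.sqrt (rdeg G w)) * v w := by
    rw [Finset.mul_sum]
    refine Finset.sum_congr rfl fun w _ => ?_
    have := hs u
    have := hs w
    field_simp
  have h3 : ∑ w, adjInd G u w / (Real.sqrt (rdeg G u) * Real.sqrt (rdeg G w)) * v w =
      (1 - μ) * v u := by linarith
  rw [h2, h3]
  have h4 : rdeg G u = Real.sqrt (rdeg G u) * Real.sqrt (rdeg G u) :=
    (Real.mul_self_sqrt (rdeg_nonneg G u)).symm
  have := hs u
  rw [show (1 - μ) * rdeg G u * (v u / Real.sqrt (rdeg G u)) =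
    (1 - μ) * (Real.sqrt (rdeg G u) * Real.sqrt (rdeg G u)) * (v u / Real.sqrt (rdeg G u)) by
      rw [← h4]]
  field_simp

/-- If the only functions that are harmonic up to a factor `1 - μ ∉ {1 - a, 1 - b}` are the
constants (with `μ = 0`), then the spectrum consists of a simple `0` and copies of `a` and `b`. -/
theorem spectrum_of_harmonic [Nonempty V] (hd : ∀ u, rdeg G u ≠ 0) {a b : ℝ} (ha : a ≠ 0)
    (hb : b ≠ 0)
    (h : ∀ (μ : ℝ) (f : V → ℝ), μ ≠ a → μ ≠ b →
      (∀ u, ∑ w, adjInd G u w * f w = (1 - μ) * rdeg G u * f u) →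
      ∃ k, (∀ u, f u = k) ∧ (μ = 0 ∨ k = 0)) :
    (∀ x ∈ spectrum G, x = 0 ∨ x = a ∨ x = b) ∧ (spectrum G).count 0 = 1 := by
  classical
  have hA := isHermitian_normalizedLaplacian G
  have hs : ∀ u, Real.sqrt (rdeg G u) ≠ 0 := fun u =>
    (Real.sqrt_ne_zero (rdeg_nonneg G u)).2 (hd u)
  constructor
  · intro x hx
    have hx' : x ∈ (normalizedLaplacian G).charpoly.roots := by
      convert hx using 1
      unfold spectrum
      congr!
    obtain ⟨v, hv0, hv⟩ := hA.exists_mulVec_eq_smul_of_mem_roots hx'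
    by_contra! hne
    obtain ⟨k, hk, hk'⟩ := h x _ hne.2.1 hne.2.2 (sum_adjInd_mul_of_eigenvector G hd hv)
    have hk0 : k = 0 := hk'.resolve_left hne.1
    apply hv0
    ext u
    have := hk u
    rw [hk0, div_eq_zero_iff] at this
    exact this.resolve_right (hs u)
  · have := hA.count_zero_eq_one (normalizedLaplacian_mulVec_sqrt G)
      (fun h0 => hs (Classical.arbitrary V) (congrFun h0 _)) (fun x hx => by
        have hx' : Matrix.mulVec (normalizedLaplacian G) x = (0 : ℝ) • x := by rw [hx, zero_smul]
        obtain ⟨k, hk, -⟩ := h 0 _ ha.symm hb.symm (sum_adjInd_mul_of_eigenvector G hd hx')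
        refine ⟨k, ?_⟩
        ext u
        rw [Pi.smul_apply, smul_eq_mul, ← hk u, div_mul_cancel₀ _ (hs u)])
    convert this using 2
    all_goals try (unfold spectrum; congr!)

/-- If `0` is a simple eigenvalue, then there are no isolated vertices. -/
theorem rdeg_ne_zero_of_count [Nontrivial V] (h : (spectrum G).count 0 = 1) (u : V) :
    rdeg G u ≠ 0 := by
  classical
  have hA := isHermitian_normalizedLaplacian G
  have hc : (normalizedLaplacian G).charpoly.roots.count 0 = 1 := by
    convert h using 2
    all_goals try (unfold spectrum; congr!)
  -- The row and column of an isolated vertex vanish, so its coordinate vector lies in the kernel.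
  have hsing : ∀ v, rdeg G v = 0 →
      Matrix.mulVec (normalizedLaplacian G) (Pi.single v (1 : ℝ)) = 0 := by
    intro v hv
    ext w
    rw [Matrix.mulVec_single_one]
    simp only [Matrix.col_apply, normalizedLaplacian_apply, adjInd_comm G w v,
      adjInd_eq_zero_of_rdeg_eq_zero G hv, Pi.zero_apply, zero_div, sub_zero]
    rw [if_neg]
    rintro ⟨rfl, h⟩
    exact h hv
  intro hu
  obtain ⟨w, hw⟩ := exists_ne u
  have hne : (Pi.single u (1 : ℝ) : V → ℝ) ≠ 0 := by
    intro h0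
    simpa using congrFun h0 u
  -- The kernel is spanned by the coordinate vector at `u`, so the degree vector vanishes at `w`.
  -- Then `w` is isolated too and gives a second, independent kernel vector.
  obtain ⟨k, hk⟩ := hA.exists_eq_smul_of_count_zero_eq_one hc (normalizedLaplacian_mulVec_sqrt G)
    (hsing u hu) hne
  have hw0 : rdeg G w = 0 := by
    have := congrFun hk w
    simpa [hw, Real.sqrt_eq_zero (rdeg_nonneg G w)] using this
  obtain ⟨k, hk⟩ := hA.exists_eq_smul_of_count_zero_eq_one hc (hsing w hw0) (hsing u hu) hne
  simpa [hw] using congrFun hk w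

open Classical in
/-- The quadratic relation satisfied by the adjacency matrix of a graph whose normalized Laplacian
has a simple eigenvalue `0` and all other eigenvalues in `{a, b}`. -/
theorem exists_quadratic_relation [Nontrivial V] {a b : ℝ}
    (hab : ∀ x ∈ spectrum G, x = 0 ∨ x = a ∨ x = b) (h0 : (spectrum G).count 0 = 1) :
    ∃ c : ℝ, c * ∑ u, rdeg G u = a * b ∧ ∀ u v,
      ∑ w, adjInd G u w * adjInd G w v / rdeg G w - (2 - a - b) * adjInd G u v +
        (if u = v then (1 - a) * (1 - b) * rdeg G u else 0) = c * rdeg G u * rdeg G v := by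
  have hA := isHermitian_normalizedLaplacian G
  have hd := rdeg_ne_zero_of_count G h0
  set s : V → ℝ := fun u => Real.sqrt (rdeg G u) with hsdef
  have hs : ∀ u, s u ≠ 0 := fun u => (Real.sqrt_ne_zero (rdeg_nonneg G u)).2 (hd u)
  have hss : ∀ u, s u * s u = rdeg G u := fun u => Real.mul_self_sqrt (rdeg_nonneg G u)
  set L := normalizedLaplacian G with hL
  have hLs : Matrix.mulVec L s = 0 := normalizedLaplacian_mulVec_sqrt G
  set Q := (L - a • 1) * (L - b • 1) with hQ
  have hLQ : L * Q = 0 := hA.mul_sub_mul_sub_eq_zero hab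
  have hs0 : s ≠ 0 := fun h => hs (Classical.arbitrary V) (congrFun h _)
  -- Each column of `Q` lies in the kernel of `L`, because `L * Q = 0`.
  have hcol : ∀ v, ∃ k : ℝ, (fun u => Q u v) = k • s := fun v =>
    hA.exists_eq_smul_of_count_zero_eq_one h0 (congrFun (congrArg Matrix.transpose hLQ) v) hLs hs0
  choose r hr using hcol
  have hr' : ∀ u v, Q u v = r v * s u := fun u v => congrFun (hr v) u
  have hLt : L.transpose = L := hA
  have hQt : Q.transpose = Q := by
    rw [hQ]
    simp only [Matrix.transpose_mul, Matrix.transpose_sub, Matrix.transpose_smul,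
      Matrix.transpose_one, hLt]
    simp only [sub_mul, mul_sub, smul_mul_assoc, mul_smul_comm, one_mul, mul_one, smul_sub]
    rw [smul_comm]
    abel
  have hQc : ∀ u v, Q u v = Q v u := fun u v => (congrFun (congrFun hQt u) v).symm
  let o := Classical.arbitrary V
  -- Symmetry of `Q` makes the coefficients proportional to `s` as well, so `Q` is a multiple of s
  -- sᵀ.
  have hrc : ∀ v, r v = r o / s o * s v := by
    intro v
    have := hQc o v
    rw [hr', hr'] at this
    have ho := hs o
    field_simp
    linarith
  refine ⟨r o / s o, ?_, ?_⟩
  · have h1 : Matrix.mulVec Q s = (a * b) • s := by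
      rw [hQ, ← Matrix.mulVec_mulVec]
      simp only [Matrix.sub_mulVec, Matrix.smul_mulVec, Matrix.one_mulVec, Matrix.mulVec_sub,
        Matrix.mulVec_smul, hLs, Matrix.mulVec_zero]
      ext j
      simp only [Pi.sub_apply, Pi.smul_apply, smul_eq_mul, Pi.zero_apply]
      ring
    have h2 := congrFun h1 o
    simp only [Matrix.mulVec, dotProduct, Pi.smul_apply, smul_eq_mul] at h2
    have h3 : ∑ x, Q o x * s x = (r o / s o * ∑ u, rdeg G u) * s o := by
      rw [Finset.mul_sum, Finset.sum_mul]
      refine Finset.sum_congr rfl fun x _ => ?_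
      rw [hr' o x, hrc x, ← hss x]
      ring
    rw [h3] at h2
    exact mul_right_cancel₀ (hs o) h2
  · intro u v
    have hLuv : ∀ u v, L u v = (if u = v then 1 else 0) - adjInd G u v / (s u * s v) := by
      intro u v
      rw [hL, normalizedLaplacian_apply]
      simp [hd, hsdef]
    have h1 : Q u v = ∑ w, ((if u = w then 1 - a else 0) - adjInd G u w / (s u * s w)) *
        ((if w = v then 1 - b else 0) - adjInd G w v / (s w * s v)) := by
      rw [hQ, Matrix.mul_apply]
      refine Finset.sum_congr rfl fun w _ => ?_
      simp only [Matrix.sub_apply, Matrix.smul_apply, Matrix.one_apply, smul_eq_mul, hLuv]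
      congr 1
      · split_ifs <;> ring
      · split_ifs <;> ring
    have h2 : ∀ w, ((if u = w then 1 - a else 0) - adjInd G u w / (s u * s w)) *
        ((if w = v then 1 - b else 0) - adjInd G w v / (s w * s v)) =
        (if u = w then (1 - a) * ((if w = v then 1 - b else 0) - adjInd G w v / (s w * s v)) else 0)
        - (if w = v then (1 - b) * (adjInd G u w / (s u * s w)) else 0) +
        (adjInd G u w * adjInd G w v / rdeg G w) / (s u * s v) := by
      intro w
      have hw := hs w
      have hu := hs u
      have hv := hs v
      rw [← hss w]
      split_ifs <;> field_simp <;> ring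
    simp only [h2, Finset.sum_add_distrib, Finset.sum_sub_distrib, Finset.sum_ite_eq,
      Finset.sum_ite_eq', Finset.mem_univ, if_true, ← Finset.sum_div] at h1
    rw [hr' u v, hrc v] at h1
    have hu := hs u
    have hv := hs v
    rw [← hss u, ← hss v]
    have h3 : r o / s o * (s u * s u) * (s v * s v) = (r o / s o * s v * s u) * (s u * s v) := by
      ring
    rw [h3, h1]
    by_cases huv : u = v
    · subst huv
      simp only [if_true]
      field_simp
      ring
    · simp only [huv, if_false]
      field_simp
      ring

end Weights

end NormLap

/-! ### Degree estimates and the central vertex -/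

namespace NormLap

section Relation

variable {V : Type*} [Fintype V] (G : SimpleGraph V)

theorem missing_term_nonneg (u v w : V) :
    0 ≤ adjInd G u w * (1 - adjInd G w v) / rdeg G w :=
  div_nonneg (mul_nonneg (adjInd_nonneg G u w) (sub_nonneg.2 (adjInd_le_one G w v)))
    (rdeg_nonneg G w)

theorem rdeg_add_one_le_card (u : V) : rdeg G u + 1 ≤ Fintype.card V := by
  classical
  have : rdeg G u + 1 ≤ ∑ _v : V, (1 : ℝ) := by
    rw [rdeg, ← Finset.add_sum_erase _ _ (Finset.mem_univ u), adjInd_self,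
      ← Finset.add_sum_erase _ (fun _ => (1 : ℝ)) (Finset.mem_univ u), zero_add, add_comm]
    gcongr
    exact adjInd_le_one G u _
  simpa using this

open Classical in
/-- The quadratic relation between the adjacency matrix and the degrees that characterizes graphs
whose normalized Laplacian has a simple eigenvalue `0` and all other eigenvalues equal to `1 / q`
or `1 + 1 / q`. -/
structure QuadraticRelation (q : ℕ) (c : ℝ) : Prop where
  one_le : 1 ≤ q
  rdeg_ne_zero : ∀ u, rdeg G u ≠ 0
  mul_sum_rdeg : c * ∑ u, rdeg G u = ((q : ℝ) + 1) / q ^ 2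
  sum_eq : ∀ u v, ∑ w, adjInd G u w * adjInd G w v / rdeg G w =
    ((q : ℝ) - 2) / q * adjInd G u v +
      (if u = v then ((q : ℝ) - 1) / q ^ 2 * rdeg G u else 0) + c * rdeg G u * rdeg G v

namespace QuadraticRelation

variable {G} {q : ℕ} {c : ℝ} (h : QuadraticRelation G q c)

include h

theorem cast_pos : (0 : ℝ) < q := by exact_mod_cast h.one_le

theorem rdeg_pos (u : V) : 0 < rdeg G u := lt_of_le_of_ne (rdeg_nonneg G u) (h.rdeg_ne_zero u).symm

theorem const_pos : 0 < c := by
  have hq := h.cast_pos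
  have h1 : 0 < c * ∑ u, rdeg G u := by rw [h.mul_sum_rdeg]; positivity
  exact pos_of_mul_pos_left h1 (Finset.sum_nonneg fun u _ => rdeg_nonneg G u)

/-- The sum of the reciprocal degrees over a neighbourhood. -/
theorem sum_neighbors (u : V) : ∑ w, adjInd G u w / rdeg G w =
    ((q : ℝ) - 1) / q ^ 2 * rdeg G u + c * rdeg G u ^ 2 := by
  have h1 := h.sum_eq u u
  simp only [adjInd_self, if_true, mul_zero, zero_add] at h1
  rw [show c * rdeg G u ^ 2 = c * rdeg G u * rdeg G u by ring, ← h1]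
  refine Finset.sum_congr rfl fun w _ => ?_
  rw [adjInd_comm G w u, adjInd_mul_self]

theorem sum_common {u v : V} (huv : G.Adj u v) :
    ∑ w, adjInd G u w * adjInd G w v / rdeg G w =
      ((q : ℝ) - 2) / q + c * rdeg G u * rdeg G v := by
  have h1 := h.sum_eq u v
  rw [adjInd_of_adj huv, if_neg huv.ne] at h1
  rw [h1]; ring

/-- The sum of the reciprocal degrees over the neighbours of `u` that are not neighbours of `v`. -/
theorem sum_missing {u v : V} (huv : G.Adj u v) :
    ∑ w, adjInd G u w * (1 - adjInd G w v) / rdeg G w =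
      ((q : ℝ) - 1) / q ^ 2 * rdeg G u + c * rdeg G u ^ 2 -
        (((q : ℝ) - 2) / q + c * rdeg G u * rdeg G v) := by
  rw [← h.sum_neighbors u, ← h.sum_common huv, ← Finset.sum_sub_distrib]
  refine Finset.sum_congr rfl fun w _ => ?_
  ring

/-- At a vertex `m` of minimal degree below q, the missing sum forces every neighbour to have
reciprocal degree at most 1/q². Summing over the neighbours of `m` then contradicts `sum_neighbors`
unless q = 1, and in that case `m` would be isolated. -/
theorem le_rdeg (u : V) : (q : ℝ) ≤ rdeg G u := by
  have hq := h.cast_pos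
  have hc := h.const_pos
  obtain ⟨m, -, hm⟩ := Finset.exists_min_image Finset.univ (rdeg G) ⟨u, Finset.mem_univ u⟩
  refine le_trans ?_ (hm u (Finset.mem_univ u))
  by_contra! hlt
  obtain ⟨k, hk⟩ := exists_nat_rdeg G m
  have hmpos := h.rdeg_pos m
  have hle : rdeg G m ≤ q - 1 := by
    rw [hk] at hlt ⊢
    have : k + 1 ≤ q := by exact_mod_cast hlt
    have : (k : ℝ) + 1 ≤ q := by exact_mod_cast this
    linarith
  have hterm : ∀ w, adjInd G m w / rdeg G w ≤ adjInd G m w * (1 / (q : ℝ) ^ 2) := by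
    intro w
    by_cases hw : G.Adj m w
    · have h1 := Finset.single_le_sum (fun x _ => missing_term_nonneg G m w x) (Finset.mem_univ w)
      rw [h.sum_missing hw] at h1
      simp only [adjInd_of_adj hw, adjInd_self, sub_zero, mul_one, one_mul] at h1 ⊢
      refine h1.trans ?_
      have h2 := hm w (Finset.mem_univ w)
      have h3 : c * rdeg G m * rdeg G m ≤ c * rdeg G m * rdeg G w :=
        mul_le_mul_of_nonneg_left h2 (by positivity)
      have hq1 : (0 : ℝ) ≤ q - 1 := by
        have : (1 : ℝ) ≤ q := by exact_mod_cast h.one_le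
        linarith
      have h4 : ((q : ℝ) - 1) / q ^ 2 * rdeg G m ≤ ((q : ℝ) - 1) / q ^ 2 * (q - 1) :=
        mul_le_mul_of_nonneg_left hle (by positivity)
      have h5 : ((q : ℝ) - 1) / q ^ 2 * (q - 1) - (q - 2) / q = 1 / q ^ 2 := by
        field_simp; ring
      nlinarith
    · simp [adjInd_of_not_adj hw]
  have hsum := Finset.sum_le_sum fun w (_ : w ∈ Finset.univ) => hterm w
  rw [h.sum_neighbors, ← Finset.sum_mul, ← rdeg] at hsum
  have h6 : ((q : ℝ) - 1) / q ^ 2 * rdeg G m + c * rdeg G m ^ 2 =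
    rdeg G m * (((q : ℝ) - 1) / q ^ 2 + c * rdeg G m) := by ring
  rw [h6] at hsum
  have h7 := le_of_mul_le_mul_left hsum hmpos
  have h8 : ((q : ℝ) - 1) / q ^ 2 < 1 / q ^ 2 := by nlinarith [mul_pos hc hmpos]
  rw [div_lt_div_iff_of_pos_right (by positivity)] at h8
  have h9 : q < 2 := by
    have : (q : ℝ) < 2 := by linarith
    exact_mod_cast this
  have h10 : q = 1 := by have := h.one_le; omega
  rw [h10] at hle
  norm_num at hle
  linarith

/-- If all neighbours of `u` have degree q, then `u` itself serves. Otherwise a neighbour `v` of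
larger degree serves: it must be adjacent to all other neighbours of `u`, and the missing sum
reduces to 1/d_v. -/
theorem exists_center_of_rdeg_eq {u : V} (hu : rdeg G u = q) :
    ∃ v, (q : ℝ) ^ 2 * c * rdeg G v = 1 := by
  classical
  have hq := h.cast_pos
  have hc := h.const_pos
  by_cases hall : ∀ w, G.Adj u w → rdeg G w = q
  · refine ⟨u, ?_⟩
    have h1 := h.sum_neighbors u
    have h2 : ∑ w, adjInd G u w / rdeg G w = 1 := by
      have : ∀ w, adjInd G u w / rdeg G w = adjInd G u w / q := by
        intro w
        by_cases hw : G.Adj u w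
        · rw [hall w hw]
        · simp [adjInd_of_not_adj hw]
      simp only [this, ← Finset.sum_div]
      rw [← rdeg, hu, div_self hq.ne']
    rw [h2, hu] at h1
    rw [hu]
    field_simp at h1
    nlinarith
  · push Not at hall
    obtain ⟨v, huv, hv⟩ := hall
    have hvq : (q : ℝ) < rdeg G v := lt_of_le_of_ne (h.le_rdeg v) (Ne.symm hv)
    have hM := h.sum_missing huv
    rw [hu] at hM
    by_cases hw : ∃ w, w ≠ v ∧ G.Adj u w ∧ ¬ G.Adj w v
    · obtain ⟨w, hwv, huw, hw⟩ := hw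
      exfalso
      -- A second missing vertex `w` gives a lower bound for the missing sum. The total of the
      -- nonnegative deficits 1/q - 1/d_x bounds 1/d_v + 1/d_w from below; the two bounds add up to
      -- c·q·d_v ≤ 0.
      have h1 := Finset.add_le_sum (fun x _ => missing_term_nonneg G u v x)
        (Finset.mem_univ v) (Finset.mem_univ w) hwv.symm
      rw [hM] at h1
      simp only [adjInd_of_adj huv, adjInd_of_adj huw, adjInd_self, adjInd_of_not_adj hw, sub_zero,
        mul_one] at h1
      have hnn : ∀ x ∈ Finset.univ, 0 ≤ adjInd G u x * (1 / q - 1 / rdeg G x) := fun x _ =>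
        mul_nonneg (adjInd_nonneg G u x)
          (sub_nonneg.2 (one_div_le_one_div_of_le hq (h.le_rdeg x)))
      have h2 := Finset.add_le_sum hnn (Finset.mem_univ v) (Finset.mem_univ w) hwv.symm
      have h3 : ∑ x, adjInd G u x * (1 / q - 1 / rdeg G x) =
          rdeg G u / q - ∑ x, adjInd G u x / rdeg G x := by
        rw [rdeg, Finset.sum_div, ← Finset.sum_sub_distrib]
        refine Finset.sum_congr rfl fun x _ => ?_
        ring
      rw [h3, h.sum_neighbors, hu, adjInd_of_adj huv, adjInd_of_adj huw] at h2
      have h4 : (q : ℝ) / q = 1 := div_self hq.ne'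
      have h5 : ((q : ℝ) - 1) / q ^ 2 * q = 1 - 1 / q := by field_simp
      have h6 : ((q : ℝ) - 2) / q = 1 - 2 * (1 / q) := by field_simp
      rw [h5, h6] at h1
      rw [h4, h5] at h2
      have h7 : 0 < c * q * rdeg G v := by have := h.rdeg_pos v; positivity
      linarith
    · push Not at hw
      refine ⟨v, ?_⟩
      have h1 : ∑ w, adjInd G u w * (1 - adjInd G w v) / rdeg G w = 1 / rdeg G v := by
        rw [Finset.sum_eq_single v]
        · simp [adjInd_of_adj huv, adjInd_self]
        · intro w _ hwv
          by_cases huw : G.Adj u w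
          · simp [adjInd_of_adj (hw w hwv huw)]
          · simp [adjInd_of_not_adj huw]
        · simp
      rw [h1] at hM
      have hvpos := h.rdeg_pos v
      have h2 : ((q : ℝ) - rdeg G v) * ((q : ℝ) ^ 2 * c * rdeg G v - 1) = 0 := by
        field_simp at hM
        nlinarith
      rcases mul_eq_zero.1 h2 with h2 | h2
      · linarith
      · linarith

/-- If all neighbours had degree at least q + 2, `sum_neighbors` would give (q - 1)(q + 2) < q²,
false for q ≥ 2. -/
theorem exists_adj_rdeg_eq (hq2 : 2 ≤ q) (hall : ∀ u, (q : ℝ) + 1 ≤ rdeg G u) (u : V) :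
    ∃ v, G.Adj u v ∧ rdeg G v = q + 1 := by
  have hq := h.cast_pos
  have hc := h.const_pos
  by_contra! hne
  have hbig : ∀ v, G.Adj u v → (q : ℝ) + 2 ≤ rdeg G v := by
    intro v huv
    have h1 := hne v huv
    have h2 := hall v
    obtain ⟨k, hk⟩ := exists_nat_rdeg G v
    rw [hk] at h1 h2 ⊢
    have h3 : q + 1 ≤ k := by exact_mod_cast h2
    have h4 : k ≠ q + 1 := by exact_mod_cast h1
    have : q + 2 ≤ k := by omega
    exact_mod_cast this
  have hterm : ∀ w ∈ Finset.univ, adjInd G u w / rdeg G w ≤ adjInd G u w * (1 / ((q : ℝ) + 2)) := by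
    intro w _
    by_cases hw : G.Adj u w
    · rw [adjInd_of_adj hw, one_mul]
      exact one_div_le_one_div_of_le (by positivity) (hbig w hw)
    · simp [adjInd_of_not_adj hw]
  have hsum := Finset.sum_le_sum hterm
  rw [h.sum_neighbors, ← Finset.sum_mul, ← rdeg] at hsum
  have hu := h.rdeg_pos u
  have h6 : ((q : ℝ) - 1) / q ^ 2 * rdeg G u + c * rdeg G u ^ 2 =
    rdeg G u * (((q : ℝ) - 1) / q ^ 2 + c * rdeg G u) := by ring
  rw [h6] at hsum
  have h7 := le_of_mul_le_mul_left hsum hu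
  have h8 : ((q : ℝ) - 1) / q ^ 2 < 1 / (q + 2) := by nlinarith [mul_pos hc hu]
  rw [div_lt_div_iff₀ (by positivity) (by positivity)] at h8
  have : (2 : ℝ) ≤ q := by exact_mod_cast hq2
  nlinarith

/-- Otherwise there are adjacent vertices `u`, `v` of degree q + 1. Comparing deficits 1/(q + 1) -
1/d_w over the `m` missing neighbours with those over all neighbours of `u` traps the integer `m`
strictly between 2 and 3. -/
theorem exists_rdeg_eq_of_two_le [Nonempty V] (hq2 : 2 ≤ q) : ∃ u, rdeg G u = q := by
  have hq := h.cast_pos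
  have hc := h.const_pos
  by_contra! hne
  have hall : ∀ u, (q : ℝ) + 1 ≤ rdeg G u := by
    intro u
    have h1 := hne u
    have h2 := h.le_rdeg u
    obtain ⟨k, hk⟩ := exists_nat_rdeg G u
    rw [hk] at h1 h2 ⊢
    have h3 : q ≤ k := by exact_mod_cast h2
    have h4 : k ≠ q := by exact_mod_cast h1
    have : q + 1 ≤ k := by omega
    exact_mod_cast this
  obtain ⟨u, -, hu⟩ := h.exists_adj_rdeg_eq hq2 hall (Classical.arbitrary V)
  obtain ⟨v, huv, hv⟩ := h.exists_adj_rdeg_eq hq2 hall u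
  have hM := h.sum_missing huv
  rw [hu, hv] at hM
  have hM' : ∑ w, adjInd G u w * (1 - adjInd G w v) / rdeg G w = (2 * q - 1) / q ^ 2 := by
    rw [hM]; field_simp; ring
  obtain ⟨m, hm⟩ : ∃ m : ℕ, ∑ w, adjInd G u w * (1 - adjInd G w v) = m := by
    classical
    refine ⟨∑ w, (if G.Adj u w then 1 else 0) * (if G.Adj w v then 0 else 1), ?_⟩
    push_cast
    refine Finset.sum_congr rfl fun w _ => ?_
    by_cases h1 : G.Adj u w <;> by_cases h2 : G.Adj w v <;> simp [adjInd, h1, h2]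
  have hdef : ∑ w, adjInd G u w * (1 - adjInd G w v) * (1 / ((q : ℝ) + 1) - 1 / rdeg G w) =
      m * (1 / ((q : ℝ) + 1)) - (2 * q - 1) / q ^ 2 := by
    rw [← hM', ← hm, Finset.sum_mul, ← Finset.sum_sub_distrib]
    refine Finset.sum_congr rfl fun w _ => ?_
    ring
  have htot : ∑ w, adjInd G u w * (1 / ((q : ℝ) + 1) - 1 / rdeg G w) =
      1 / q ^ 2 - c * (q + 1) ^ 2 := by
    have : ∑ w, adjInd G u w * (1 / ((q : ℝ) + 1) - 1 / rdeg G w) =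
        rdeg G u * (1 / ((q : ℝ) + 1)) - ∑ w, adjInd G u w / rdeg G w := by
      rw [rdeg, Finset.sum_mul, ← Finset.sum_sub_distrib]
      refine Finset.sum_congr rfl fun w _ => ?_
      ring
    rw [this, h.sum_neighbors, hu]
    field_simp
    ring
  have hnn : ∀ w, 0 ≤ 1 / ((q : ℝ) + 1) - 1 / rdeg G w := fun w =>
    sub_nonneg.2 (one_div_le_one_div_of_le (by positivity) (hall w))
  have hlow : 0 ≤ m * (1 / ((q : ℝ) + 1)) - (2 * q - 1) / q ^ 2 := by
    rw [← hdef]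
    exact Finset.sum_nonneg fun w _ => mul_nonneg (mul_nonneg (adjInd_nonneg G u w)
      (sub_nonneg.2 (adjInd_le_one G w v))) (hnn w)
  have hupp : m * (1 / ((q : ℝ) + 1)) - (2 * q - 1) / q ^ 2 ≤ 1 / q ^ 2 - c * (q + 1) ^ 2 := by
    rw [← hdef, ← htot]
    refine Finset.sum_le_sum fun w _ => mul_le_mul_of_nonneg_right ?_ (hnn w)
    exact mul_le_of_le_one_right (adjInd_nonneg G u w) (by linarith [adjInd_nonneg G w v])
  have hq2' : (2 : ℝ) ≤ q := by exact_mod_cast hq2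
  have h1 : (2 * (q : ℝ) - 1) / q ^ 2 ≤ m / (q + 1) := by
    rw [mul_one_div] at hlow; linarith
  have h2 : (m : ℝ) / (q + 1) < 2 / q := by
    have h3 : (2 * (q : ℝ) - 1) / q ^ 2 + 1 / q ^ 2 = 2 / q := by field_simp; ring
    have h4 : 0 < c * ((q : ℝ) + 1) ^ 2 := by positivity
    rw [mul_one_div] at hupp
    linarith
  rw [div_le_div_iff₀ (by positivity) (by positivity)] at h1
  rw [div_lt_div_iff₀ (by positivity) (by positivity)] at h2
  have h5 : (2 : ℝ) < m := by
    by_contra! hle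
    nlinarith [mul_le_mul_of_nonneg_right hle (sq_nonneg (q : ℝ))]
  have h6 : (m : ℝ) < 3 := by
    by_contra! hle
    nlinarith
  have h7 : 2 < m := by exact_mod_cast h5
  have h8 : m < 3 := by exact_mod_cast h6
  omega

/-- Otherwise all degrees are 2. Then c = 1/4 by `sum_neighbors`, and `mul_sum_rdeg` forces four
vertices. -/
theorem exists_rdeg_eq_of_eq_one [Nonempty V] (hq1 : q = 1) (hcard : Fintype.card V ≤ 3) :
    ∃ u, rdeg G u = q := by
  by_contra! hne
  subst hq1
  have h3 : (Fintype.card V : ℝ) ≤ 3 := by exact_mod_cast hcard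
  have hall : ∀ u, rdeg G u = 2 := by
    intro u
    have h0 := rdeg_add_one_le_card G u
    have h1 := hne u
    have h2 := h.le_rdeg u
    obtain ⟨k, hk⟩ := exists_nat_rdeg G u
    rw [hk] at h0 h1 h2 ⊢
    have h0' : (k : ℝ) ≤ 2 := by linarith
    have h4 : 1 ≤ k := by exact_mod_cast h2
    have h5 : k ≠ 1 := by exact_mod_cast h1
    have h6 : k ≤ 2 := by exact_mod_cast h0'
    have : k = 2 := by omega
    exact_mod_cast this
  have h1 := h.sum_neighbors (Classical.arbitrary V)
  simp only [hall, ← Finset.sum_div] at h1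
  rw [← rdeg, hall] at h1
  have h2 := h.mul_sum_rdeg
  simp only [hall, Finset.sum_const, Finset.card_univ, nsmul_eq_mul] at h2
  norm_num at h1 h2
  nlinarith [h.const_pos]

theorem adj_and_rdeg_eq_of_center {u : V} (hu : (q : ℝ) ^ 2 * c * rdeg G u = 1) {v : V}
    (hv : v ≠ u) : G.Adj u v ∧ rdeg G v = q := by
  classical
  have hq := h.cast_pos
  have hd := h.rdeg_pos
  -- `F w` is √(d_u d_w) times the (u, w) entry of the projection onto the 1/q-eigenspace, which is
  -- 1 + 1/q - L with its kernel component removed. The weighted sum of squares below is therefore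
  -- d_u times the diagonal entry at `u`, and `hu` says that this entry is 0.
  set F : V → ℝ := fun w =>
    adjInd G u w + (if u = w then rdeg G u / q else 0) - q * c * rdeg G u * rdeg G w with hF
  have hexp : ∀ w, F w ^ 2 / rdeg G w = adjInd G u w / rdeg G w +
      (if u = w then rdeg G u / q ^ 2 - 2 * c * rdeg G u ^ 2 else 0) +
      (q * c * rdeg G u) ^ 2 * rdeg G w - 2 * q * c * rdeg G u * adjInd G u w := by
    intro w
    have hw := (hd w).ne'
    have hA := adjInd_mul_self G u w
    by_cases huw : u = w
    · subst huw
      simp only [hF, adjInd_self, if_true]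
      field_simp
      ring
    · simp only [hF, huw, if_false]
      field_simp
      linear_combination hA
  have hsum : ∑ w, F w ^ 2 / rdeg G w = 0 := by
    simp only [hexp, Finset.sum_add_distrib, Finset.sum_sub_distrib, ← Finset.mul_sum,
      Finset.sum_ite_eq, Finset.mem_univ, if_true]
    rw [h.sum_neighbors, ← rdeg]
    have h1 : ((q : ℝ) * c * rdeg G u) ^ 2 * ∑ i, rdeg G i =
        q ^ 2 * c * rdeg G u ^ 2 * (c * ∑ i, rdeg G i) := by ring
    rw [h1, h.mul_sum_rdeg]
    field_simp
    linear_combination -((q : ℝ) * rdeg G u) * hu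
  have hF0 : F v = 0 := by
    have := (Finset.sum_eq_zero_iff_of_nonneg fun w _ =>
      div_nonneg (sq_nonneg (F w)) (hd w).le).1 hsum v (Finset.mem_univ v)
    rcases div_eq_zero_iff.1 this with h1 | h1
    · exact pow_eq_zero_iff two_ne_zero |>.1 h1
    · exact absurd h1 (hd v).ne'
  have h1 : adjInd G u v = rdeg G v / q := by
    simp only [hF, hv.symm, if_false] at hF0
    field_simp
    linear_combination (q : ℝ) * hF0 + rdeg G v * hu
  have hadj : G.Adj u v := by
    by_contra hn
    rw [adjInd_of_not_adj hn] at h1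
    have : 0 < rdeg G v / q := div_pos (hd v) hq
    linarith
  refine ⟨hadj, ?_⟩
  rw [adjInd_of_adj hadj] at h1
  field_simp at h1
  linarith

/-- If `x` and `z` were not adjacent, their common-neighbour sum would be cq². The centre alone
already contributes 1/d_u = cq², leaving no room for `y`. -/
theorem adj_trans_of_center {u : V} (hu : (q : ℝ) ^ 2 * c * rdeg G u = 1) {x y z : V}
    (hx : x ≠ u) (hy : y ≠ u) (hz : z ≠ u) (hxz : x ≠ z) (hxy : G.Adj x y) (hyz : G.Adj y z) :
    G.Adj x z := by
  classical
  by_contra hn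
  have hq := h.cast_pos
  have h1 := h.sum_eq x z
  obtain ⟨hux, hdx⟩ := h.adj_and_rdeg_eq_of_center hu hx
  obtain ⟨huz, hdz⟩ := h.adj_and_rdeg_eq_of_center hu hz
  rw [adjInd_of_not_adj hn, if_neg hxz, hdx, hdz] at h1
  have h2 := Finset.add_le_sum (f := fun w => adjInd G x w * adjInd G w z / rdeg G w)
    (fun w _ => div_nonneg (mul_nonneg (adjInd_nonneg G x w) (adjInd_nonneg G w z))
      (rdeg_nonneg G w)) (Finset.mem_univ u) (Finset.mem_univ y) hy.symm
  rw [h1, adjInd_of_adj hux.symm, adjInd_of_adj huz, adjInd_of_adj hxy, adjInd_of_adj hyz] at h2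
  have h3 : 0 < (rdeg G y)⁻¹ := inv_pos.2 (h.rdeg_pos y)
  have h4 : 1 / rdeg G u = c * q * q := by
    have := h.rdeg_pos u
    field_simp
    linarith
  norm_num at h2 h4
  linarith

end QuadraticRelation

end Relation

end NormLap

/-! ### Reconstructing the friendship graph -/

namespace NormLap

section Friendship

variable {V : Type*} [Fintype V] {G : SimpleGraph V}

theorem QuadraticRelation.exists_center [Nonempty V] {q : ℕ} {c : ℝ}
    (h : QuadraticRelation G q c) (hq : 2 ≤ q ∨ q = 1 ∧ Fintype.card V ≤ 3) :
    ∃ u, (q : ℝ) ^ 2 * c * rdeg G u = 1 := by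
  rcases hq with hq | ⟨hq, hcard⟩
  · obtain ⟨u, hu⟩ := h.exists_rdeg_eq_of_two_le hq
    exact h.exists_center_of_rdeg_eq hu
  · obtain ⟨u, hu⟩ := h.exists_rdeg_eq_of_eq_one hq hcard
    exact h.exists_center_of_rdeg_eq hu

theorem exists_quadraticRelation [Nontrivial V] {q : ℕ} (hq : 1 ≤ q)
    (hmem : ∀ x ∈ spectrum G, x = 0 ∨ x = 1 / (q : ℝ) ∨ x = 1 + 1 / (q : ℝ))
    (h0 : (spectrum G).count 0 = 1) : ∃ c, QuadraticRelation G q c := by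
  classical
  have hq' : (0 : ℝ) < q := by exact_mod_cast hq
  obtain ⟨c, hc, hrel⟩ := exists_quadratic_relation G hmem (by convert h0)
  refine ⟨c, hq, rdeg_ne_zero_of_count G h0, ?_, fun u v => ?_⟩
  · rw [hc]; field_simp
  · have h1 := hrel u v
    have h2 : (2 - 1 / (q : ℝ) - (1 + 1 / q)) = ((q : ℝ) - 2) / q := by field_simp; ring
    have h3 : (1 - 1 / (q : ℝ)) * (1 - (1 + 1 / q)) * rdeg G u =
      -(((q : ℝ) - 1) / q ^ 2 * rdeg G u) := by field_simp; ring
    rw [h2, h3] at h1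
    by_cases huv : u = v
    · subst huv
      simp only [if_true] at h1 ⊢
      linarith
    · simp only [huv, if_false] at h1 ⊢
      linarith

/-- A type with an equivalence relation all of whose `p` classes have `q` elements is `p × q`. -/
theorem exists_equiv_prod_of_setoid {α : Type*} [Fintype α] (r : Setoid α) {p q : ℕ}
    (hq : 0 < q) (hcard : Fintype.card α = p * q)
    (hclass : ∀ a, Nat.card {b // r b a} = q) :
    ∃ e : α ≃ Fin p × Fin q, ∀ a b, (e a).1 = (e b).1 ↔ r a b := by
  classical
  have hfib : ∀ y : Quotient r, Nonempty ({a // Quotient.mk r a = y} ≃ Fin q) := by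
    intro y
    induction y using Quotient.inductionOn with
    | h a =>
      have e1 : {b // Quotient.mk r b = Quotient.mk r a} ≃ {b // r b a} :=
        Equiv.subtypeEquivRight fun b => Quotient.eq
      exact ⟨e1.trans (Finite.equivFinOfCardEq (hclass a))⟩
  let g := fun y => (hfib y).some
  let e0 : α ≃ Quotient r × Fin q := (Equiv.sigmaFiberEquiv (Quotient.mk r)).symm.trans
    ((Equiv.sigmaCongrRight g).trans (Equiv.sigmaEquivProd _ _))
  have he0 : ∀ a, (e0 a).1 = Quotient.mk r a := fun a => rfl
  have hp : Nat.card (Quotient r) = p := by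
    have h1 := Nat.card_congr e0
    rw [Nat.card_prod, Nat.card_eq_fintype_card, hcard, Nat.card_fin] at h1
    exact (Nat.eq_of_mul_eq_mul_right hq h1).symm
  let e1 : Quotient r ≃ Fin p := Finite.equivFinOfCardEq hp
  refine ⟨e0.trans (e1.prodCongr (Equiv.refl _)), fun a b => ?_⟩
  change e1 (e0 a).1 = e1 (e0 b).1 ↔ _
  rw [e1.injective.eq_iff, he0, he0]
  exact Quotient.eq

theorem QuadraticRelation.nonempty_iso_friendshipGraph [Nonempty V] {p q : ℕ} {c : ℝ}
    (h : QuadraticRelation G q c) (hcard : Fintype.card V = p * q + 1)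
    (hq : 2 ≤ q ∨ q = 1 ∧ Fintype.card V ≤ 3) : Nonempty (G ≃g friendshipGraph p q) := by
  classical
  obtain ⟨u, hu⟩ := h.exists_center hq
  let r : Setoid {v // v ≠ u} :=
    { r := fun x y => x = y ∨ G.Adj x y
      iseqv :=
        { refl := fun x => Or.inl rfl
          symm := fun hxy => hxy.imp Eq.symm SimpleGraph.Adj.symm
          trans := by
            intro x y z hxy hyz
            rcases hxy with rfl | hxy
            · exact hyz
            rcases hyz with rfl | hyz
            · exact Or.inr hxy
            by_cases hxz : x = z
            · exact Or.inl hxz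
            · exact Or.inr (h.adj_trans_of_center hu x.2 y.2 z.2
                (fun h => hxz (Subtype.ext h)) hxy hyz) } }
  have hr : ∀ x y, r x y ↔ x = y ∨ G.Adj x y := fun _ _ => Iff.rfl
  have hclass : ∀ a, Nat.card {b // r b a} = q := by
    intro a
    obtain ⟨hua, hda⟩ := h.adj_and_rdeg_eq_of_center hu a.2
    have hdeg : G.degree a = q := by
      have := natCast_degree G a.1
      rw [hda] at this
      exact_mod_cast this
    -- The class of `a` contains `a` but not `u`, while its neighbourhood contains `u` but not `a`;
    -- exchanging the two gives the bijection.
    have e : {b // r b a} ≃ G.neighborSet a :=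
      { toFun := fun b => if hb : b.1 = a then ⟨u, hua.symm⟩ else
          ⟨b.1.1, (((hr _ _).1 b.2).resolve_left hb).symm⟩
        invFun := fun w => if hw : w.1 = u then ⟨a, r.refl a⟩ else
          ⟨⟨w.1, hw⟩, Or.inr (SimpleGraph.Adj.symm w.2)⟩
        left_inv := by
          rintro ⟨b, hb⟩
          by_cases hba : b = a
          · simp [hba]
          · simp [hba, b.2]
        right_inv := by
          rintro ⟨w, hw⟩
          by_cases hwu : w = u
          · simp [hwu]
          · have hwa : w ≠ a.1 := (G.ne_of_adj hw).symm
            have : (⟨w, hwu⟩ : {v // v ≠ u}) ≠ a := fun h => hwa (congrArg Subtype.val h)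
            simp [hwu, this] }
    rw [Nat.card_congr e, Nat.card_eq_fintype_card, G.card_neighborSet_eq_degree]
    exact hdeg
  have hsub : Fintype.card {v // v ≠ u} = p * q := by
    rw [Fintype.card_subtype_compl, hcard]
    simp
  obtain ⟨e, he⟩ := exists_equiv_prod_of_setoid r h.one_le hsub hclass
  let f : {v // v = u} ⊕ {v // v ≠ u} ≃ Fin 1 ⊕ Fin p × Fin q :=
    Equiv.sumCongr (Equiv.ofUnique _ _) e
  let k : V ≃ Fin 1 ⊕ Fin p × Fin q := (Equiv.sumCompl (· = u)).symm.trans f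
  have hku : k u = Sum.inl 0 := by simp [k, f]
  have hkv : ∀ x : {v // v ≠ u}, k x = Sum.inr (e x) := by
    intro x
    simp [k, f]
  refine ⟨⟨k, ?_⟩⟩
  intro x y
  by_cases hx : x = u
  · subst hx
    by_cases hy : y = x
    · subst hy
      simp
    · have := (h.adj_and_rdeg_eq_of_center hu hy).1
      simp [hku, hkv ⟨y, hy⟩, friendshipGraph, join, this]
  · by_cases hy : y = u
    · subst hy
      have := (h.adj_and_rdeg_eq_of_center hu hx).1.symm
      simp [hku, hkv ⟨x, hx⟩, friendshipGraph, join, this]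
    · have h1 := he ⟨x, hx⟩ ⟨y, hy⟩
      rw [hr] at h1
      rw [hkv ⟨x, hx⟩, hkv ⟨y, hy⟩]
      have h2 : (friendshipGraph p q).Adj (Sum.inr (e ⟨x, hx⟩)) (Sum.inr (e ⟨y, hy⟩)) ↔
          (e ⟨x, hx⟩).1 = (e ⟨y, hy⟩).1 ∧ (e ⟨x, hx⟩).2 ≠ (e ⟨y, hy⟩).2 := by
        simp [friendshipGraph, join, copies]
      rw [h2, h1]
      constructor
      · rintro ⟨h3 | h3, h4⟩
        · exact absurd (by rw [h3]) h4
        · exact h3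
      · intro h3
        refine ⟨Or.inr h3, fun h4 => ?_⟩
        have h5 := e.injective (Prod.ext (h1.2 (Or.inr h3)) h4)
        exact h3.ne (congrArg Subtype.val h5)

end Friendship

end NormLap

/-! ### Spectra of friendship and complete bipartite graphs -/

namespace NormLap

section Spectra

theorem sum_adjInd_friendshipGraph_inl {p q : ℕ} (f : Fin 1 ⊕ Fin p × Fin q → ℝ) (o : Fin 1) :
    ∑ w, adjInd (friendshipGraph p q) (Sum.inl o) w * f w = ∑ x, f (Sum.inr x) := by
  rw [Fintype.sum_sum_type]
  simp [adjInd, friendshipGraph, join, Subsingleton.elim o 0]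

theorem sum_adjInd_friendshipGraph_inr {p q : ℕ} (f : Fin 1 ⊕ Fin p × Fin q → ℝ)
    (i : Fin p) (j : Fin q) :
    ∑ w, adjInd (friendshipGraph p q) (Sum.inr (i, j)) w * f w =
      f (Sum.inl 0) + ∑ j', f (Sum.inr (i, j')) - f (Sum.inr (i, j)) := by
  classical
  rw [Fintype.sum_sum_type]
  have h1 : ∀ x : Fin p × Fin q,
      adjInd (friendshipGraph p q) (Sum.inr (i, j)) (Sum.inr x) * f (Sum.inr x) =
        if i = x.1 then (f (Sum.inr x) - if j = x.2 then f (Sum.inr x) else 0) else 0 := by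
    rintro ⟨i', j'⟩
    by_cases hi : i = i' <;> by_cases hj : j = j' <;>
      simp [adjInd, friendshipGraph, join, copies, hi, hj]
  simp only [h1, Fintype.sum_prod_type]
  rw [Finset.sum_eq_single i]
  · simp only [if_true, Finset.sum_sub_distrib, Finset.sum_ite_eq, Finset.mem_univ]
    simp [adjInd, friendshipGraph, join]
    ring
  · intro b _ hb
    simp [hb.symm]
  · simp

theorem rdeg_friendshipGraph_inl {p q : ℕ} (o : Fin 1) :
    rdeg (friendshipGraph p q) (Sum.inl o) = p * q := by
  have := sum_adjInd_friendshipGraph_inl (p := p) (q := q) (fun _ => 1) o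
  simpa [rdeg] using this

theorem rdeg_friendshipGraph_inr {p q : ℕ} (x : Fin p × Fin q) :
    rdeg (friendshipGraph p q) (Sum.inr x) = q := by
  have := sum_adjInd_friendshipGraph_inr (p := p) (q := q) (fun _ => 1) x.1 x.2
  simpa [rdeg] using this

theorem rdeg_friendshipGraph_ne_zero {p q : ℕ} (hp : 1 ≤ p) (hq : 1 ≤ q)
    (v : Fin 1 ⊕ Fin p × Fin q) : rdeg (friendshipGraph p q) v ≠ 0 := by
  rcases v with o | x
  · rw [rdeg_friendshipGraph_inl]; positivity
  · rw [rdeg_friendshipGraph_inr]; positivity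

theorem spectrum_friendshipGraph {p q : ℕ} (hp : 1 ≤ p) (hq : 1 ≤ q) :
    (∀ x ∈ spectrum (friendshipGraph p q), x = 0 ∨ x = 1 / (q : ℝ) ∨ x = 1 + 1 / (q : ℝ)) ∧
      (spectrum (friendshipGraph p q)).count 0 = 1 := by
  have hq0 : (0 : ℝ) < q := by exact_mod_cast hq
  have hp0 : (0 : ℝ) < p := by exact_mod_cast hp
  refine spectrum_of_harmonic _ (rdeg_friendshipGraph_ne_zero hp hq) (by positivity)
    (by positivity) fun μ f h1 h2 hf => ?_
  have h1' : 1 - q * μ ≠ 0 := fun h => h1 (by field_simp; linarith)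
  have h2' : (1 - μ) * q + 1 ≠ 0 := fun h => h2 (by field_simp; linarith)
  have hleaf : ∀ i j, ((1 - μ) * q + 1) * f (Sum.inr (i, j)) =
      f (Sum.inl 0) + ∑ j', f (Sum.inr (i, j')) := by
    intro i j
    have := hf (Sum.inr (i, j))
    rw [sum_adjInd_friendshipGraph_inr, rdeg_friendshipGraph_inr] at this
    linarith
  -- Since μ ≠ 1 + 1/q, `f` is constant on each clique; the clique sum is then q times that value.
  have hconst : ∀ i j, (1 - q * μ) * f (Sum.inr (i, j)) = f (Sum.inl 0) := by
    intro i j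
    have h3 : ∀ j', f (Sum.inr (i, j')) = f (Sum.inr (i, j)) := fun j' =>
      mul_left_cancel₀ h2' ((hleaf i j').trans (hleaf i j).symm)
    have h4 := hleaf i j
    simp only [h3, Finset.sum_const, Finset.card_univ, Fintype.card_fin, nsmul_eq_mul] at h4
    linarith
  have hcenter := hf (Sum.inl 0)
  rw [sum_adjInd_friendshipGraph_inl, rdeg_friendshipGraph_inl] at hcenter
  have h5 : ∑ x : Fin p × Fin q, (1 - q * μ) * f (Sum.inr x) = p * q * f (Sum.inl 0) := by
    simp [hconst]
  rw [← Finset.mul_sum, hcenter] at h5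
  have h6 : μ * f (Sum.inl 0) = 0 := by
    have h7 : (p * q * ((1 - μ) * q + 1)) * (μ * f (Sum.inl 0)) = 0 := by linear_combination -h5
    exact (mul_eq_zero.1 h7).resolve_left (mul_ne_zero (by positivity) h2')
  refine ⟨f (Sum.inl 0), ?_, mul_eq_zero.1 h6⟩
  rintro (o | ⟨i, j⟩)
  · rw [Subsingleton.elim o 0]
  · apply mul_left_cancel₀ h1'
    rw [hconst]
    linear_combination (q : ℝ) * h6

theorem sum_adjInd_completeBipartiteGraph_inl {r s : ℕ} (f : Fin r ⊕ Fin s → ℝ) (i : Fin r) :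
    ∑ w, adjInd (completeBipartiteGraph (Fin r) (Fin s)) (Sum.inl i) w * f w =
      ∑ j, f (Sum.inr j) := by
  rw [Fintype.sum_sum_type]
  simp [adjInd]

theorem sum_adjInd_completeBipartiteGraph_inr {r s : ℕ} (f : Fin r ⊕ Fin s → ℝ) (j : Fin s) :
    ∑ w, adjInd (completeBipartiteGraph (Fin r) (Fin s)) (Sum.inr j) w * f w =
      ∑ i, f (Sum.inl i) := by
  rw [Fintype.sum_sum_type]
  simp [adjInd]

theorem rdeg_completeBipartiteGraph_inl {r s : ℕ} (i : Fin r) :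
    rdeg (completeBipartiteGraph (Fin r) (Fin s)) (Sum.inl i) = s := by
  have := sum_adjInd_completeBipartiteGraph_inl (s := s) (fun _ => 1) i
  simpa [rdeg] using this

theorem rdeg_completeBipartiteGraph_inr {r s : ℕ} (j : Fin s) :
    rdeg (completeBipartiteGraph (Fin r) (Fin s)) (Sum.inr j) = r := by
  have := sum_adjInd_completeBipartiteGraph_inr (r := r) (fun _ => 1) j
  simpa [rdeg] using this

theorem rdeg_completeBipartiteGraph_ne_zero {r s : ℕ} (hr : 1 ≤ r) (hs : 1 ≤ s)
    (v : Fin r ⊕ Fin s) : rdeg (completeBipartiteGraph (Fin r) (Fin s)) v ≠ 0 := by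
  rcases v with i | j
  · rw [rdeg_completeBipartiteGraph_inl]; positivity
  · rw [rdeg_completeBipartiteGraph_inr]; positivity

theorem spectrum_completeBipartiteGraph {r s : ℕ} (hr : 1 ≤ r) (hs : 1 ≤ s) :
    (∀ x ∈ spectrum (completeBipartiteGraph (Fin r) (Fin s)), x = 0 ∨ x = 1 ∨ x = 2) ∧
      (spectrum (completeBipartiteGraph (Fin r) (Fin s))).count 0 = 1 := by
  have hr0 : (0 : ℝ) < r := by exact_mod_cast hr
  have hs0 : (0 : ℝ) < s := by exact_mod_cast hs
  have : Nonempty (Fin r ⊕ Fin s) := ⟨Sum.inl ⟨0, hr⟩⟩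
  refine spectrum_of_harmonic _ (rdeg_completeBipartiteGraph_ne_zero hr hs) one_ne_zero
    two_ne_zero fun μ f h1 h2 hf => ?_
  have h1' : 1 - μ ≠ 0 := sub_ne_zero.2 h1.symm
  have h2' : 2 - μ ≠ 0 := sub_ne_zero.2 h2.symm
  have hl : ∀ i, ∑ j, f (Sum.inr j) = (1 - μ) * s * f (Sum.inl i) := fun i => by
    have := hf (Sum.inl i)
    rwa [sum_adjInd_completeBipartiteGraph_inl, rdeg_completeBipartiteGraph_inl] at this
  have hr : ∀ j, ∑ i, f (Sum.inl i) = (1 - μ) * r * f (Sum.inr j) := fun j => by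
    have := hf (Sum.inr j)
    rwa [sum_adjInd_completeBipartiteGraph_inr, rdeg_completeBipartiteGraph_inr] at this
  let i₀ : Fin r := ⟨0, by assumption⟩
  let j₀ : Fin s := ⟨0, hs⟩
  have hlc : ∀ i, f (Sum.inl i) = f (Sum.inl i₀) := fun i =>
    mul_left_cancel₀ (mul_ne_zero h1' hs0.ne') ((hl i).symm.trans (hl i₀))
  have hrc : ∀ j, f (Sum.inr j) = f (Sum.inr j₀) := fun j =>
    mul_left_cancel₀ (mul_ne_zero h1' hr0.ne') ((hr j).symm.trans (hr j₀))
  have hl0 := hl i₀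
  have hr0' := hr j₀
  simp only [hrc, Finset.sum_const, Finset.card_univ, Fintype.card_fin, nsmul_eq_mul] at hl0
  simp only [hlc, Finset.sum_const, Finset.card_univ, Fintype.card_fin, nsmul_eq_mul] at hr0'
  have hb : f (Sum.inr j₀) = (1 - μ) * f (Sum.inl i₀) :=
    mul_left_cancel₀ hs0.ne' (by linarith)
  have ha : f (Sum.inl i₀) = (1 - μ) * f (Sum.inr j₀) :=
    mul_left_cancel₀ hr0.ne' (by linarith)
  have h6 : μ * f (Sum.inl i₀) = 0 := by
    have h7 : (2 - μ) * (μ * f (Sum.inl i₀)) = 0 := by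
      linear_combination ha + (1 - μ) * hb
    exact (mul_eq_zero.1 h7).resolve_left h2'
  refine ⟨f (Sum.inl i₀), ?_, mul_eq_zero.1 h6⟩
  rintro (i | j)
  · exact hlc i
  · rw [hrc, hb]
    linear_combination -h6

theorem card_and_sum_of_mem_zero_one_two (M : Multiset ℝ)
    (hM : ∀ x ∈ M, x = 0 ∨ x = 1 ∨ x = 2) :
    Multiset.card M = M.count 0 + M.count 1 + M.count 2 ∧
      M.sum = M.count 1 + 2 * M.count 2 := by
  induction M using Multiset.induction_on with
  | empty => simp
  | cons a M ih =>
    obtain ⟨h1, h2⟩ := ih fun x hx => hM x (Multiset.mem_cons_of_mem hx)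
    rcases hM a (Multiset.mem_cons_self a M) with rfl | rfl | rfl
    · simp [h1, h2]; omega
    · simp [h1, h2]; constructor
      · omega
      · ring
    · simp [h1, h2]; constructor
      · omega
      · ring

/-- Given the multiplicity of 0, cardinality and sum are two independent linear equations in the
multiplicities of 1 and 2. -/
theorem multiset_eq_of_mem_zero_one_two {M N : Multiset ℝ}
    (hM : ∀ x ∈ M, x = 0 ∨ x = 1 ∨ x = 2) (hN : ∀ x ∈ N, x = 0 ∨ x = 1 ∨ x = 2)
    (h0 : M.count 0 = N.count 0) (hcard : Multiset.card M = Multiset.card N)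
    (hsum : M.sum = N.sum) : M = N := by
  obtain ⟨hM1, hM2⟩ := card_and_sum_of_mem_zero_one_two M hM
  obtain ⟨hN1, hN2⟩ := card_and_sum_of_mem_zero_one_two N hN
  rw [hM2, hN2] at hsum
  have hsum' : M.count 1 + 2 * M.count 2 = N.count 1 + 2 * N.count 2 := by exact_mod_cast hsum
  have h1 : M.count 1 = N.count 1 := by omega
  have h2 : M.count 2 = N.count 2 := by omega
  ext x
  by_cases hx : x = 0 ∨ x = 1 ∨ x = 2
  · rcases hx with rfl | rfl | rfl <;> assumption
  · rw [Multiset.count_eq_zero_of_notMem fun h => hx (hM x h),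
      Multiset.count_eq_zero_of_notMem fun h => hx (hN x h)]

theorem spectrum_completeBipartiteGraph_eq_star {p r s : ℕ} (hp : 1 ≤ p) (hr : 1 ≤ r)
    (hs : 1 ≤ s) (hrs : r + s = p + 1) :
    spectrum (completeBipartiteGraph (Fin r) (Fin s)) = spectrum (friendshipGraph p 1) := by
  obtain ⟨hK, hK0⟩ := spectrum_completeBipartiteGraph hr hs
  obtain ⟨hF, hF0⟩ := spectrum_friendshipGraph hp le_rfl
  have hcard : Fintype.card (Fin r ⊕ Fin s) = Fintype.card (Fin 1 ⊕ Fin p × Fin 1) := by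
    simp; omega
  refine multiset_eq_of_mem_zero_one_two hK ?_ (hK0.trans hF0.symm) ?_ ?_
  · norm_num at hF ⊢
    exact hF
  · rw [card_spectrum, card_spectrum, hcard]
  · rw [sum_spectrum _ (rdeg_completeBipartiteGraph_ne_zero hr hs),
      sum_spectrum _ (rdeg_friendshipGraph_ne_zero hp le_rfl), hcard]

/-- The centre of the friendship graph is adjacent to all other vertices. No vertex of `K_{r,s}` is
when both sides have at least two elements. -/
theorem not_nonempty_iso_star {p r s q : ℕ} (hr : 2 ≤ r) (hs : 2 ≤ s) :
    ¬ Nonempty (completeBipartiteGraph (Fin r) (Fin s) ≃g friendshipGraph p q) := by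
  rintro ⟨φ⟩
  have hadj : ∀ w, w ≠ φ.symm (Sum.inl 0) →
      (completeBipartiteGraph (Fin r) (Fin s)).Adj (φ.symm (Sum.inl 0)) w := by
    intro w hw
    rw [← φ.map_adj_iff, φ.apply_symm_apply]
    have hw' : φ w ≠ Sum.inl 0 := fun h => hw (by rw [← h, φ.symm_apply_apply])
    rcases hφ : φ w with o | x
    · exact absurd (hφ.trans (by rw [Subsingleton.elim o 0])) hw'
    · simp [friendshipGraph, join]
  have : Nontrivial (Fin r) := Fin.nontrivial_iff_two_le.2 hr
  have : Nontrivial (Fin s) := Fin.nontrivial_iff_two_le.2 hs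
  rcases hv : φ.symm (Sum.inl 0) with i | j
  · obtain ⟨i', hi'⟩ := exists_ne i
    have := hadj (Sum.inl i') (by simp [hv, hi'])
    simp [hv] at this
  · obtain ⟨j', hj'⟩ := exists_ne j
    have := hadj (Sum.inr j') (by simp [hv, hj'])
    simp [hv] at this

/-! ### Conclusion -/

theorem determinedBySpectrum_friendshipGraph {p q : ℕ} (hpq : 2 ≤ q ∨ (q = 1 ∧ p ≤ 2)) :
    DeterminedBySpectrum.{0, u} (friendshipGraph p q) := by
  intro W _ H hH
  have hq : 1 ≤ q := by omega
  have hcard : Fintype.card W = p * q + 1 := by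
    have := congrArg Multiset.card hH
    rw [card_spectrum, card_spectrum] at this
    simpa [add_comm] using this
  -- For p = 0 the graph is a single vertex, where the quadratic relation is not available, and the
  -- number of vertices suffices.
  rcases Nat.eq_zero_or_pos p with rfl | hp
  · have hc : Fintype.card W = Fintype.card (Fin 1 ⊕ Fin 0 × Fin q) := by simp [hcard]
    have hs : Subsingleton W := Fintype.card_le_one_iff_subsingleton.1 (by omega)
    have e := Fintype.equivOfCardEq hc
    exact ⟨⟨e, fun {x y} => by rw [Subsingleton.elim x y]; simp⟩⟩
  · have : Nontrivial W := Fintype.one_lt_card_iff_nontrivial.1 (by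
      rw [hcard]; have := Nat.mul_pos hp hq; omega)
    obtain ⟨h1, h2⟩ := spectrum_friendshipGraph hp hq
    rw [← hH] at h1 h2
    obtain ⟨c, hc⟩ := exists_quadraticRelation hq h1 h2
    refine hc.nonempty_iso_friendshipGraph hcard (hpq.imp_right fun h => ⟨h.1, ?_⟩)
    rw [hcard, h.1]
    omega

end Spectra

end NormLap

theorem theorem1 (p q : ℕ) :
    ((2 ≤ q ∨ (q = 1 ∧ p ≤ 2)) →
      NormLap.DeterminedBySpectrum.{0, u} (NormLap.friendshipGraph p q)) ∧
    ((q = 1 ∧ 3 ≤ p) →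
      ∃ r s : ℕ, 1 ≤ r ∧ 1 ≤ s ∧ r + s = p + 1 ∧
        ¬ Nonempty (completeBipartiteGraph (Fin r) (Fin s) ≃g NormLap.friendshipGraph p q) ∧
        NormLap.spectrum (completeBipartiteGraph (Fin r) (Fin s)) =
          NormLap.spectrum (NormLap.friendshipGraph p q)) := by
  refine ⟨NormLap.determinedBySpectrum_friendshipGraph, ?_⟩
  rintro ⟨rfl, hp⟩
  exact ⟨2, p - 1, by omega, by omega, by omega,
    NormLap.not_nonempty_iso_star le_rfl (by omega),
    NormLap.spectrum_completeBipartiteGraph_eq_star (by omega) (by omega) (by omega) (by omega)⟩
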